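/- Let $\varphi_e$ be the $e$-th partial computable function $\mathbb{N}\rightharpoonup\mathbb{N}$ in a standard acceptable enumeration and $W_e$ its domain. A number $e$ is an index of a computable group $G$, whose universe is a (necessarily computable) set of natural numbers, if $\varphi_e$ is total and is the characteristic function of the (coded) atomic diagram of $G$, i.e. of the set of true statements $a=b$ and $a\cdot b=c$ with $a,b,c\in G$. Let $A$ be the set of all indices of computable groups, and let $B\subseteq A$ be the set of indices of those computable groups that are torsion (every element has finite order). Theorem. Detecting torsion groups is $\Pi^0_2$-complete in the class of computable groups. That is: (1) there is a $\Pi^0_2$ set $R\subseteq\mathbb{N}$ with $A\cap R=B$; (2) for every $\Pi^0_2$ set $S\subseteq\mathbb{N}$ there is a computable function $f:\mathbb{N}\to\mathbb{N}$ with values in $A$ such that, for all $e$, $e\in S$ if and only if $f(e)\in B$. Moreover, there is a computable function $f:\mathbb{N}\to\mathbb{N}$ such that, for every $e$, $f(e)$ is an index of a computable abelian group $G_e$ with universe $\mathbb{N}$ for which the following hold. (a) If $W_e$ is infinite, then $G_e$ is a torsion group and $G_e\cong\bigoplus_{i\in\mathbb{N}}\mathbb{Z}/2^{a_i}\mathbb{Z}$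 for some integers $a_i\ge 1$. (b) If $W_e$ is finite with $k$ elements, then $G_e$ is not a torsion group and $G_e\cong\mathbb{Z}/2^{a_1}\mathbb{Z}\times\cdots\times\mathbb{Z}/2^{a_k}\mathbb{Z}\times\mathbb{Z}$ for some integers $a_1,\dots,a_k\ge 1$. -/

import Mathlib

/-- `phi e` is the `e`-th partial computable function in the standard acceptable enumeration. -/
def phi (e : ℕ) : ℕ →. ℕ :=
  Nat.Partrec.Code.eval (Denumerable.ofNat Nat.Partrec.Code e)

/-- `ceSet e` is the `e`-th computably enumerable set, the domain of `phi e`. -/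
def ceSet (e : ℕ) : Set ℕ :=
  {n | (phi e n).Dom}

/-- The class of `Π⁰₂` sets of natural numbers. -/
def PiZeroTwo : Set (Set ℕ) :=
  {S | ∃ R : ℕ × ℕ × ℕ → Prop, ComputablePred R ∧
    ∀ e, e ∈ S ↔ ∀ x, ∃ y, R (e, x, y)}

/-- The atomic diagram (as a set of codes) of a group whose universe is the set `U` of natural
numbers: the sentence `a = b` is coded by `⟨0, ⟨a, b⟩⟩` and `a * b = c` by
`⟨1, ⟨a, ⟨b, c⟩⟩⟩`, where `a`, `b`, `c` name elements of the universe. -/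
def atomicDiagram (U : Set ℕ) (G : Group U) : Set ℕ :=
  {n | ∃ a b : U, a = b ∧ n = Nat.pair 0 (Nat.pair a b)} ∪
  {n | ∃ a b c : U, a * b = c ∧ n = Nat.pair 1 (Nat.pair a (Nat.pair b c))}

/-- `e` is an index of the computable group `G` with universe `U`: the function `phi e` is (total and
equal to) the characteristic function of the atomic diagram of `G`. -/
def IsIndexOf (e : ℕ) (U : Set ℕ) (G : Group U) : Prop :=
  ∀ n, (n ∈ atomicDiagram U G → 1 ∈ phi e n) ∧ (n ∉ atomicDiagram U G → 0 ∈ phi e n)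

/-- The set of all indices of computable groups. The universe may be any computable set of
natural numbers, finite or infinite. -/
def computableGroupIndices : Set ℕ :=
  {e | ∃ (U : Set ℕ) (G : Group U), IsIndexOf e U G}

/-- The set of indices of computable groups that have the property `P`. -/
def indicesWithProperty (P : ∀ (G : Type) [Group G], Prop) : Set ℕ :=
  {e | ∃ (U : Set ℕ) (G : Group U), IsIndexOf e U G ∧ P U}

/-- Detecting `P` is `Γ` in the class of computable groups with index set `A`. -/
def DetectingIsIn (Γ : Set (Set ℕ)) (A : Set ℕ) (P : ∀ (G : Type) [Group G], Prop) : Prop :=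
  ∃ S ∈ Γ, A ∩ S = A ∩ indicesWithProperty P

/-- Detecting `P` is `Γ`-hard in the class of computable groups with index set `A`. -/
def DetectingIsHard (Γ : Set (Set ℕ)) (A : Set ℕ) (P : ∀ (G : Type) [Group G], Prop) : Prop :=
  ∀ S ∈ Γ, ∃ f : ℕ → ℕ, Computable f ∧ (∀ e, f e ∈ A) ∧
    ∀ e, e ∈ S ↔ f e ∈ A ∩ indicesWithProperty P

/-- Detecting `P` is `Γ`-complete in the class of computable groups with index set `A`. -/
def DetectingIsComplete (Γ : Set (Set ℕ)) (A : Set ℕ) (P : ∀ (G : Type) [Group G], Prop) : Prop :=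
  DetectingIsIn Γ A P ∧ DetectingIsHard Γ A P

theorem mem_atomicDiagram_eq {U : Set ℕ} {G : Group U} {a b : ℕ} :
    Nat.pair 0 (Nat.pair a b) ∈ atomicDiagram U G ↔ a ∈ U ∧ a = b := by
  constructor
  · rintro (⟨x, y, h, e⟩ | ⟨x, y, z, h, e⟩)
    · simp only [Nat.pair_eq_pair] at e
      obtain ⟨-, rfl, rfl⟩ := e
      exact ⟨x.2, by rw [h]⟩
    · simp [Nat.pair_eq_pair] at e
  · rintro ⟨h, rfl⟩
    exact Or.inl ⟨⟨a, h⟩, ⟨a, h⟩, rfl, rfl⟩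

theorem mem_atomicDiagram_mul {U : Set ℕ} {G : Group U} {a b c : U} :
    Nat.pair 1 (Nat.pair a (Nat.pair b c)) ∈ atomicDiagram U G ↔ a * b = c := by
  constructor
  · rintro (⟨x, y, h, e⟩ | ⟨x, y, z, h, e⟩)
    · simp [Nat.pair_eq_pair] at e
    · simp only [Nat.pair_eq_pair, true_and] at e
      obtain ⟨h1, h2, h3⟩ := e
      rw [Subtype.ext h1, Subtype.ext h2, Subtype.ext h3, h]
  · intro h
    exact Or.inr ⟨a, b, c, h, rfl⟩

/-- An index determines the atomic diagram. -/
theorem IsIndexOf.diagram_eq {e : ℕ} {U V : Set ℕ} {G : Group U} {H : Group V}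
    (hG : IsIndexOf e U G) (hH : IsIndexOf e V H) : atomicDiagram U G = atomicDiagram V H := by
  ext n
  constructor
  · intro h
    by_contra h2
    exact absurd (Part.mem_unique ((hG n).1 h) ((hH n).2 h2)) (by decide)
  · intro h
    by_contra h2
    exact absurd (Part.mem_unique ((hH n).1 h) ((hG n).2 h2)) (by decide)

/-- An index determines the group, so "the group with index `e`" is well defined. -/
theorem IsIndexOf.mem_indicesWithProperty_iff {e : ℕ} {U : Set ℕ} {G : Group U}
    (hG : IsIndexOf e U G) (P : ∀ (G : Type) [Group G], Prop) :
    e ∈ indicesWithProperty P ↔ P U := by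
  constructor
  · rintro ⟨V, H, hH, hP⟩
    have hd := hG.diagram_eq hH
    have hUV : U = V := by
      ext a
      have := @mem_atomicDiagram_eq U G a a
      rw [hd, mem_atomicDiagram_eq] at this
      simpa using this.symm
    subst hUV
    have hGH : G = H := by
      apply Group.ext
      ext a b : 2
      have h1 := (@mem_atomicDiagram_mul U G a b (G.mul a b)).2 rfl
      rw [hd] at h1
      exact ((@mem_atomicDiagram_mul U H a b (G.mul a b)).1 h1).symm
    subst hGH
    exact hP
  · intro h
    exact ⟨U, G, hG, h⟩

/-! Upper bound: an element `a` of a group has finite order iff `a ^ (n + 2) = a` for some `n`.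
Products are found by search in the atomic diagram, so `searchOrder` is uniformly partial
computable, and being torsion says that it halts on every input, which is `Π⁰₂`.

Hardness: every integer has a unique finite expansion with digits 0, 1 in base -2, with no sign
needed. Cut the positions into blocks ending where `p` holds and discard carries out of a block: a
finite block of length `m` then carries `ℤ/2^m`, an endless block carries `ℤ`, and a natural number,
read through its binary digits, is an element of the direct sum (`exists_equiv_of_infinite`,
`exists_equiv_of_finite`). The addition is computable from `p` alone, without knowing whether the
current block will ever end. Taking for `p` the stages at which elements enter `W_e` makes each new
element close a block: the group is torsion iff `W_e` is infinite. Since infinitude of `W_e` is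
`Π⁰₂`-hard (`exists_computable_ceSet_infinite_iff`), so is torsion. -/

namespace BlockSum

open Finset

/-! ### Addition in base -2 with carries cut at block ends. -/

section Addition

variable (p : ℕ → Prop) [DecidablePred p]

/-- The carry (shifted by one, so that it lies in `{0, 1, 2}`) into position `n` in the addition of
`a` and `b` in base `-2`, where carries out of the positions satisfying `p` are discarded. -/
def carry (a b : ℕ) : ℕ → ℕ
  | 0 => 1
  | n + 1 => if p n then 1 else 2 - (a / 2 ^ n % 2 + b / 2 ^ n % 2 + carry a b n + 1) / 2

/-- Addition in base `-2`, where carries out of the positions satisfying `p` are discarded. -/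
def blockAdd (a b : ℕ) : ℕ :=
  ∑ n ∈ range (a + b + 2), (a / 2 ^ n % 2 + b / 2 ^ n % 2 + carry p a b n + 1) % 2 * 2 ^ n

variable {p}

theorem carry_le (a b n : ℕ) : carry p a b n ≤ 2 := by
  cases n with
  | zero => simp [carry]
  | succ n => rw [carry]; split_ifs <;> omega

theorem div_two_pow_eq_zero {a n : ℕ} (h : a ≤ n) : a / 2 ^ n = 0 :=
  Nat.div_eq_of_lt (h.trans_lt n.lt_two_pow_self)

/-- All digits of `a` and `b` vanish from position `a + b` on. A true carry of -1 may remain there;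
as -1 is written 11 in base -2, it needs at most two more positions. This is why `blockAdd` stops at
`a + b + 2`. -/
theorem carry_last (a b : ℕ) : carry p a b (a + b + 2) = 1 := by
  have h := carry_le (p := p) a b (a + b)
  rw [carry, carry, div_two_pow_eq_zero (a := a) (by omega), div_two_pow_eq_zero (a := b) (by omega),
    div_two_pow_eq_zero (a := a) (by omega), div_two_pow_eq_zero (a := b) (by omega)]
  split_ifs <;> omega

variable {H : Type*} [AddCommGroup H]

/-- A sequence whose terms satisfy the relations of the place values in base `-2`, cut off after the
positions satisfying `p`. -/
def IsChain (p : ℕ → Prop) [DecidablePred p] (x : ℕ → H) : Prop :=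
  ∀ n, (2 : ℤ) • x n = if p n then 0 else -x (n + 1)

/-- The value of `a` when its binary digits are given the place values `x`. -/
def value (x : ℕ → H) (a : ℕ) : H :=
  ∑ i ∈ a.bitIndices.toFinset, x i

theorem value_sum_two_pow (x : ℕ → H) (s : Finset ℕ) : value x (∑ i ∈ s, 2 ^ i) = ∑ i ∈ s, x i := by
  rw [value, Finset.toFinset_bitIndices_sum_two_pow]

theorem value_eq_sum_range (x : ℕ → H) {a N : ℕ} (h : a ≤ N) :
    value x a = ∑ i ∈ range N, ((a / 2 ^ i % 2 : ℕ) : ℤ) • x i := by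
  have hs : a.bitIndices.toFinset = (range N).filter fun i => a / 2 ^ i % 2 = 1 := by
    ext i
    simp only [List.mem_toFinset, Nat.mem_bitIndices, Nat.testBit_eq_decide_div_mod_eq,
      decide_eq_true_eq, mem_filter, mem_range]
    refine ⟨fun hi => ⟨?_, hi⟩, fun hi => hi.2⟩
    by_contra hN
    rw [div_two_pow_eq_zero (by omega)] at hi
    simp at hi
  rw [value, hs, sum_filter]
  refine sum_congr rfl fun i _ => ?_
  rcases Nat.mod_two_eq_zero_or_one (a / 2 ^ i) with h | h <;> simp [h]

theorem value_blockAdd_eq_sum (x : ℕ → H) (a b : ℕ) :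
    value x (blockAdd p a b) = ∑ n ∈ range (a + b + 2),
      (((a / 2 ^ n % 2 + b / 2 ^ n % 2 + carry p a b n + 1) % 2 : ℕ) : ℤ) • x n := by
  have h : blockAdd p a b = ∑ n ∈ (range (a + b + 2)).filter
      (fun n => (a / 2 ^ n % 2 + b / 2 ^ n % 2 + carry p a b n + 1) % 2 = 1), 2 ^ n := by
    rw [blockAdd, sum_filter]
    refine sum_congr rfl fun n _ => ?_
    rcases Nat.mod_two_eq_zero_or_one (a / 2 ^ n % 2 + b / 2 ^ n % 2 + carry p a b n + 1)
      with h | h <;> simp [h]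
  rw [h, value_sum_two_pow, sum_filter]
  refine sum_congr rfl fun n _ => ?_
  rcases Nat.mod_two_eq_zero_or_one (a / 2 ^ n % 2 + b / 2 ^ n % 2 + carry p a b n + 1)
    with h | h <;> simp [h]

/-- Loop invariant of the addition: the digits already written plus the pending true carry have the
value of the digits already read. -/
theorem IsChain.sum_add_carry {x : ℕ → H} (hx : IsChain p x) (a b n : ℕ) :
    ∑ i ∈ range n, (((a / 2 ^ i % 2 + b / 2 ^ i % 2 + carry p a b i + 1) % 2 : ℕ) : ℤ) • x i
      + ((carry p a b n : ℤ) - 1) • x n =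
    ∑ i ∈ range n, (((a / 2 ^ i % 2 : ℕ) : ℤ) + ((b / 2 ^ i % 2 : ℕ) : ℤ)) • x i := by
  induction n with
  | zero => simp [carry]
  | succ n ih =>
    rw [sum_range_succ, sum_range_succ, ← ih, add_assoc (G := H), add_assoc (G := H)]
    congr 1
    have hc := carry_le (p := p) a b n
    set c := carry p a b n
    set v := a / 2 ^ n % 2 + b / 2 ^ n % 2 + c + 1 with hv
    -- The true carry is `c - 1`, so the total at position `n` is `v - 2 = v % 2 + 2 * (v / 2 - 1)`.
    -- The even part moves on with its sign reversed, or vanishes at a block end. Since `v ≤ 5`, the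
    -- natural subtraction `2 - v / 2` does not truncate.
    have hstep : ((carry p a b (n + 1) : ℤ) - 1) • x (n + 1) =
        (((v / 2 : ℕ) : ℤ) - 1) • ((2 : ℤ) • x n) := by
      rw [hx n, carry]
      split_ifs with hp
      · simp
      · rw [← hv, Nat.cast_sub (by omega), smul_neg, ← neg_smul]
        congr 1
        push_cast
        ring
    rw [hstep, smul_smul, ← add_smul, ← add_smul]
    congr 1
    omega

theorem IsChain.value_blockAdd {x : ℕ → H} (hx : IsChain p x) (a b : ℕ) :
    value x (blockAdd p a b) = value x a + value x b := by
  have h := hx.sum_add_carry a b (a + b + 2)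
  rw [carry_last] at h
  rw [value_blockAdd_eq_sum, value_eq_sum_range x (a := a) (N := a + b + 2) (by omega),
    value_eq_sum_range x (a := b) (N := a + b + 2) (by omega), ← sum_add_distrib]
  simpa [add_smul] using h

/-- The values are closed under addition, so only negatives of the generators are at issue: `-x n =
x n + x (n + 1)` inside a block, and `-x n = x n` at its end. -/
theorem IsChain.value_surjective {x : ℕ → H} (hx : IsChain p x)
    (hgen : AddSubgroup.closure (Set.range x) = ⊤) : Function.Surjective (value x) := by
  have hmem : ∀ n, ∃ a, value x a = x n := fun n => ⟨∑ i ∈ {n}, 2 ^ i, by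
    rw [value_sum_two_pow, sum_singleton]⟩
  have hadd : ∀ g h, (∃ a, value x a = g) → (∃ b, value x b = h) → ∃ c, value x c = g + h := by
    rintro _ _ ⟨a, rfl⟩ ⟨b, rfl⟩
    exact ⟨_, hx.value_blockAdd a b⟩
  have hzero : ∃ a, value x a = 0 := ⟨0, by simp [value]⟩
  have hneg : ∀ n, ∃ a, value x a = -x n := by
    intro n
    have hn := hx n
    rw [two_smul] at hn
    split_ifs at hn with hp
    · rw [neg_eq_of_add_eq_zero_left hn]
      exact hmem n
    · have : -x n = x n + x (n + 1) := by
        rw [neg_eq_iff_add_eq_zero, ← add_assoc, hn, neg_add_cancel]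
      rw [this]
      exact hadd _ _ (hmem _) (hmem _)
  have hsum : ∀ s : Finset ℕ, ∃ a, value x a = -∑ i ∈ s, x i := by
    intro s
    induction s using Finset.induction_on with
    | empty => simpa using hzero
    | insert i s hi ih =>
      rw [sum_insert hi, neg_add]
      exact hadd _ _ (hneg i) ih
  intro g
  have hg : g ∈ AddSubgroup.closure (Set.range x) := hgen ▸ AddSubgroup.mem_top g
  induction hg using AddSubgroup.closure_induction with
  | mem g hg => obtain ⟨n, rfl⟩ := hg; exact hmem n
  | zero => exact hzero
  | add g h _ _ ihg ihh => exact hadd _ _ ihg ihh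
  | neg g _ ih => obtain ⟨a, rfl⟩ := ih; exact hsum _

/-- At the least position `j` where two expansions differ, `χ` cannot see the later places and the
earlier ones agree, so the images differ by exactly `χ (x j)`. -/
theorem value_injective {x : ℕ → H}
    (hsep : ∀ j, ∃ (K : Type) (_ : AddCommGroup K) (χ : H →+ K),
      χ (x j) ≠ 0 ∧ ∀ i, j < i → χ (x i) = 0) :
    Function.Injective (value x) := by
  intro a b hab
  by_contra hne
  have hne' : (symmDiff a.bitIndices.toFinset b.bitIndices.toFinset).Nonempty := by
    rw [nonempty_iff_ne_empty, Ne, ← bot_eq_empty, symmDiff_eq_bot]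
    exact fun h => hne (Finset.equivBitIndices.injective h)
  obtain ⟨j, hj, hmin⟩ : ∃ j ∈ symmDiff a.bitIndices.toFinset b.bitIndices.toFinset,
      ∀ i < j, i ∉ symmDiff a.bitIndices.toFinset b.bitIndices.toFinset :=
    ⟨_, min'_mem _ hne', fun i hi hmem => (min'_le _ _ hmem).not_gt hi⟩
  obtain ⟨K, _, χ, hχj, hχ⟩ := hsep j
  have hsplit : ∀ s : Finset ℕ, χ (∑ i ∈ s, x i) =
      ∑ i ∈ s.filter (· < j), χ (x i) + if j ∈ s then χ (x j) else 0 := by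
    intro s
    rw [map_sum, ← sum_filter_add_sum_filter_not s (· < j), ← sum_ite_eq' s j fun i => χ (x i)]
    congr 1
    rw [sum_filter]
    refine sum_congr rfl fun i _ => ?_
    rcases lt_trichotomy i j with h | rfl | h
    · simp [h, h.ne]
    · simp
    · simp [h.not_gt, h.ne', hχ i h]
  have hfilter : a.bitIndices.toFinset.filter (· < j) = b.bitIndices.toFinset.filter (· < j) := by
    ext i
    simp only [mem_filter]
    refine and_congr_left fun hi => ?_
    have := hmin i hi
    rw [mem_symmDiff] at this
    tauto
  have h := congrArg χ hab
  rw [value, value, hsplit, hsplit, hfilter, add_right_inj] at h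
  rw [mem_symmDiff] at hj
  rcases hj with ⟨h1, h2⟩ | ⟨h1, h2⟩
  · rw [if_pos h1, if_neg h2] at h
    exact hχj h
  · rw [if_pos h1, if_neg h2] at h
    exact hχj h.symm

end Addition

/-! ### The group on `ℕ` as a direct sum of blocks. -/

section Blocks

variable (p : ℕ → Prop) [DecidablePred p]

/-- The distance from `n` to the beginning of its block, where the blocks end at the positions
satisfying `p`. -/
def offset : ℕ → ℕ
  | 0 => 0
  | n + 1 => if p n then 0 else offset n + 1

variable {p}

theorem offset_add {j n : ℕ} (h : Nat.count p (j + n) = Nat.count p j) :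
    offset p (j + n) = offset p j + n := by
  induction n with
  | zero => rfl
  | succ n ih =>
    have h1 : Nat.count p j ≤ Nat.count p (j + n) := Nat.count_monotone p (by omega)
    rw [← add_assoc, Nat.count_succ] at h
    rw [← add_assoc, offset]
    split_ifs at h ⊢ with hp
    · omega
    · rw [ih (by omega), add_assoc]

theorem offset_eq_add_sub {i j : ℕ} (hij : j ≤ i) (h : Nat.count p i = Nat.count p j) :
    offset p i = offset p j + (i - j) := by
  have := offset_add (p := p) (j := j) (n := i - j) (by rwa [Nat.add_sub_cancel' hij])
  rwa [Nat.add_sub_cancel' hij] at this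

variable {H : Type} [AddCommGroup H]

/-- The place values determined by generators `g i` of the blocks. -/
def placeValue (p : ℕ → Prop) [DecidablePred p] (g : ℕ → H) (j : ℕ) : H :=
  ((-2 : ℤ) ^ offset p j) • g (Nat.count p j)

theorem isChain_placeValue {g : ℕ → H}
    (hg : ∀ j, p j → ((2 : ℤ) ^ (offset p j + 1)) • g (Nat.count p j) = 0) :
    IsChain p (placeValue p g) := by
  intro n
  rw [placeValue, placeValue, offset, Nat.count_succ, smul_smul]
  split_ifs with hp
  · have : (2 : ℤ) * (-2) ^ offset p n = (-1) ^ offset p n * 2 ^ (offset p n + 1) := by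
      rw [neg_pow, pow_succ]; ring
    rw [this, mul_smul, hg n hp, smul_zero]
  · rw [add_zero, ← neg_smul]
    congr 1
    ring

/-- The place value at the start of a block is the generator of that block. -/
theorem closure_range_placeValue {g : ℕ → H} {s : Set ℕ}
    (hs : ∀ i ∈ s, ∃ j, Nat.count p j = i ∧ offset p j = 0)
    (hg : AddSubgroup.closure (g '' s) = ⊤) :
    AddSubgroup.closure (Set.range (placeValue p g)) = ⊤ := by
  rw [eq_top_iff, ← hg]
  refine AddSubgroup.closure_mono ?_
  rintro _ ⟨i, hi, rfl⟩
  obtain ⟨j, rfl, hj⟩ := hs i hi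
  exact ⟨j, by simp [placeValue, hj]⟩

theorem neg_two_pow_ne_zero (k : ℕ) : (((-2) ^ k : ℤ) : ZMod (2 ^ (k + 1))) ≠ 0 := by
  rw [Ne, ZMod.intCast_zmod_eq_zero_iff_dvd]
  intro h
  have := Int.natAbs_dvd_natAbs.2 h
  simp only [Int.natAbs_natCast, Int.natAbs_pow, Int.reduceNeg, Int.natAbs_neg,
    Int.reduceAbs] at this
  exact absurd ((Nat.pow_dvd_pow_iff_le_right (by norm_num)).1 this) (by omega)

theorem neg_two_pow_eq_zero {m k : ℕ} (h : k < m) : (((-2) ^ m : ℤ) : ZMod (2 ^ (k + 1))) = 0 := by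
  rw [ZMod.intCast_zmod_eq_zero_iff_dvd, neg_pow]
  push_cast
  exact (pow_dvd_pow 2 h).mul_left _

/-- Reduce the block of `j` modulo `2 ^ (offset p j + 1)`: there `(-2) ^ offset p j` is nonzero,
while the later places of the block carry higher powers and vanish. The other blocks are killed. -/
theorem placeValue_separated {g : ℕ → H}
    (hsep : ∀ j, ∃ χ : H →+ ZMod (2 ^ (offset p j + 1)), χ (g (Nat.count p j)) = 1 ∧
      ∀ i, Nat.count p i ≠ Nat.count p j → χ (g (Nat.count p i)) = 0) (j : ℕ) :
    ∃ (K : Type) (_ : AddCommGroup K) (χ : H →+ K), χ (placeValue p g j) ≠ 0 ∧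
      ∀ i, j < i → χ (placeValue p g i) = 0 := by
  obtain ⟨χ, h1, h0⟩ := hsep j
  refine ⟨_, inferInstance, χ, ?_, fun i hi => ?_⟩
  · rw [placeValue, map_zsmul, h1, zsmul_one]
    exact neg_two_pow_ne_zero _
  · rw [placeValue, map_zsmul]
    by_cases hij : Nat.count p i = Nat.count p j
    · rw [hij, h1, zsmul_one]
      exact neg_two_pow_eq_zero (by rw [offset_eq_add_sub hi.le hij]; omega)
    · rw [h0 i hij, smul_zero]

/-- If the generators `g` satisfy the relations of a direct sum of blocks, then `blockAdd` is the
addition of `H`, transported to `ℕ`. -/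
theorem exists_equiv_blockAdd {g : ℕ → H} {s : Set ℕ}
    (hrel : ∀ j, p j → ((2 : ℤ) ^ (offset p j + 1)) • g (Nat.count p j) = 0)
    (hs : ∀ i ∈ s, ∃ j, Nat.count p j = i ∧ offset p j = 0)
    (hgen : AddSubgroup.closure (g '' s) = ⊤)
    (hsep : ∀ j, ∃ χ : H →+ ZMod (2 ^ (offset p j + 1)), χ (g (Nat.count p j)) = 1 ∧
      ∀ i, Nat.count p i ≠ Nat.count p j → χ (g (Nat.count p i)) = 0) :
    ∃ E : ℕ ≃ H, ∀ a b, E (blockAdd p a b) = E a + E b :=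
  have hx := isChain_placeValue hrel
  ⟨Equiv.ofBijective (value (placeValue p g)) ⟨value_injective (placeValue_separated hsep),
    hx.value_surjective (closure_range_placeValue hs hgen)⟩, hx.value_blockAdd⟩

/-- Block `i + 1` starts just after the `i`-th position satisfying `p`. The bound is not strict: if
`p` holds at only `k` positions, block `k` still exists and is the endless one. -/
theorem exists_block_start {i : ℕ} (h : ∀ hf : {i | p i}.Finite, i ≤ hf.toFinset.card) :
    ∃ j, Nat.count p j = i ∧ offset p j = 0 := by
  cases i with
  | zero => exact ⟨0, Nat.count_zero p, rfl⟩
  | succ i =>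
    have hp : p (Nat.nth p i) := Nat.nth_mem i fun hf => h hf
    refine ⟨Nat.nth p i + 1, ?_, by rw [offset, if_pos hp]⟩
    rw [Nat.count_succ, if_pos hp, Nat.count_nth fun hf => h hf]

/-- The right-hand side is the offset of the last position of the block of `j`. It makes reduction
from the full order of the block to `2 ^ (offset p j + 1)` possible. -/
theorem offset_le_offset_nth_count {j : ℕ}
    (h : ∀ hf : {i | p i}.Finite, Nat.count p j < hf.toFinset.card) :
    offset p j ≤ offset p (Nat.nth p (Nat.count p j)) := by
  have hle : j ≤ Nat.nth p (Nat.count p j) := by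
    by_contra! hlt
    have h1 := Nat.count_monotone p (Nat.succ_le_of_lt hlt)
    rw [Nat.succ_eq_add_one, Nat.count_succ, if_pos (Nat.nth_mem _ h), Nat.count_nth h] at h1
    omega
  rw [offset_eq_add_sub hle (Nat.count_nth h)]
  omega

/-- The exponent of `2` in the order of the `i`-th block. -/
noncomputable def exponent (p : ℕ → Prop) [DecidablePred p] (i : ℕ) : ℕ :=
  offset p (Nat.nth p i) + 1

theorem two_pow_offset_dvd {j : ℕ}
    (h : ∀ hf : {i | p i}.Finite, Nat.count p j < hf.toFinset.card) :
    2 ^ (offset p j + 1) ∣ 2 ^ exponent p (Nat.count p j) :=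
  pow_dvd_pow 2 (Nat.succ_le_succ (offset_le_offset_nth_count h))

theorem zsmul_one_exponent {j : ℕ} (hj : p j) :
    ((2 : ℤ) ^ (offset p j + 1)) • (1 : ZMod (2 ^ exponent p (Nat.count p j))) = 0 := by
  rw [zsmul_one, ZMod.intCast_zmod_eq_zero_iff_dvd, exponent, Nat.nth_count hj]
  push_cast
  rfl

theorem exists_equiv_of_infinite (h : {i | p i}.Infinite) :
    ∃ E : ℕ ≃ DirectSum ℕ fun i => ZMod (2 ^ exponent p i),
      ∀ a b, E (blockAdd p a b) = E a + E b := by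
  have hlt : ∀ j, ∀ hf : {i | p i}.Finite, Nat.count p j < hf.toFinset.card :=
    fun j hf => absurd hf h
  refine exists_equiv_blockAdd (g := fun i => DirectSum.of (fun i => ZMod (2 ^ exponent p i)) i 1)
    (s := Set.univ) ?_ (fun i _ => exists_block_start fun hf => absurd hf h) ?_ ?_
  · intro j hj
    rw [← map_zsmul, zsmul_one_exponent hj, map_zero]
  · rw [eq_top_iff]
    rintro x -
    induction x using DirectSum.induction_on with
    | zero => exact zero_mem _
    | of i z =>
      have : DirectSum.of (fun i => ZMod (2 ^ exponent p i)) i z =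
          (z.cast : ℤ) • DirectSum.of (fun i => ZMod (2 ^ exponent p i)) i 1 := by
        rw [← map_zsmul, zsmul_one, ZMod.intCast_cast, ZMod.cast_id]
      rw [this]
      exact zsmul_mem (AddSubgroup.subset_closure (Set.mem_image_of_mem _ (Set.mem_univ i))) _
    | add x y hx hy => exact add_mem hx hy
  · intro j
    -- The separating map: project to the block of `j`, then reduce the modulus.
    refine ⟨(ZMod.castHom (two_pow_offset_dvd (hlt j)) _).toAddMonoidHom.comp
      (DFinsupp.evalAddMonoidHom (Nat.count p j)), ?_, fun i hi => ?_⟩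
    · change ZMod.castHom (two_pow_offset_dvd (hlt j)) (ZMod (2 ^ (offset p j + 1)))
        (DirectSum.of (fun i => ZMod (2 ^ exponent p i)) (Nat.count p j) 1 (Nat.count p j)) = 1
      rw [DirectSum.of_eq_same, map_one]
    · change ZMod.castHom (two_pow_offset_dvd (hlt j)) (ZMod (2 ^ (offset p j + 1)))
        (DirectSum.of (fun i => ZMod (2 ^ exponent p i)) (Nat.count p i) 1 (Nat.count p j)) = 0
      rw [DirectSum.of_eq_of_ne _ _ _ hi.symm, map_zero]

theorem count_le_card (hf : {i | p i}.Finite) (j : ℕ) : Nat.count p j ≤ hf.toFinset.card := by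
  rw [Nat.count_eq_card_filter_range]
  exact card_le_card fun i hi => by simpa using (mem_filter.1 hi).2

theorem exists_equiv_of_finite (hf : {i | p i}.Finite) {k : ℕ} (hk : hf.toFinset.card = k) :
    ∃ E : ℕ ≃ (∀ i : Fin k, ZMod (2 ^ exponent p i)) × ℤ,
      ∀ a b, E (blockAdd p a b) = E a + E b := by
  let g : ℕ → (∀ i : Fin k, ZMod (2 ^ exponent p i)) × ℤ := fun i =>
    if h : i < k then (Pi.single ⟨i, h⟩ 1, 0) else (0, 1)
  have hg : ∀ {i} (h : i < k), g i = (Pi.single ⟨i, h⟩ 1, 0) := fun h => dif_pos h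
  have hg' : ∀ {i}, ¬ i < k → g i = (0, 1) := fun h => dif_neg h
  have hcount := hk ▸ count_le_card hf
  -- The `k` closed blocks have indices below `k`; index `k` is the endless block, which carries
  -- `ℤ`.
  refine exists_equiv_blockAdd (g := g) (s := Set.Iic k) ?_
    (fun i hi => exists_block_start fun _ => hk ▸ hi) ?_ ?_
  · intro j hj
    have hlt : Nat.count p j < k := by
      have := hcount (j + 1)
      rw [Nat.count_succ, if_pos hj] at this
      omega
    rw [hg hlt, Prod.smul_mk, smul_zero, ← Pi.single_smul]
    rw [zsmul_one_exponent hj, Pi.single_zero]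
    rfl
  · rw [eq_top_iff]
    rintro ⟨x, z⟩ -
    have : (x, z) = ∑ i : Fin k, ((x i).cast : ℤ) • g i + z • g k := by
      rw [hg' (lt_irrefl k)]
      have h1 : ∀ i : Fin k, ((x i).cast : ℤ) • g i = (Pi.single i (x i), 0) := by
        intro i
        rw [hg i.2, Prod.smul_mk, smul_zero, ← Pi.single_smul, zsmul_one, ZMod.intCast_cast,
          ZMod.cast_id]
      simp only [h1]
      ext1
      · simp [Prod.fst_sum, Finset.univ_sum_single]
      · simp [Prod.snd_sum]
    rw [this]
    exact add_mem (sum_mem fun i _ => zsmul_mem (AddSubgroup.subset_closure (Set.mem_image_of_mem g (Set.mem_Iic.2 i.2.le))) _)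
      (zsmul_mem (AddSubgroup.subset_closure (Set.mem_image_of_mem g (Set.mem_Iic.2 le_rfl))) _)
  · intro j
    by_cases hj : Nat.count p j < k
    · refine ⟨(ZMod.castHom (two_pow_offset_dvd fun _ => hk ▸ hj) _).toAddMonoidHom.comp
        ((Pi.evalAddMonoidHom (fun i : Fin k => ZMod (2 ^ exponent p i))
          ⟨Nat.count p j, hj⟩).comp (AddMonoidHom.fst _ _)), ?_,
        fun i hi => ?_⟩
      · rw [hg hj]
        simpa using ZMod.cast_one (R := ZMod (2 ^ (offset p j + 1)))
          (two_pow_offset_dvd fun _ => hk ▸ hj)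
      · by_cases hi' : Nat.count p i < k
        · rw [hg hi']
          have : (⟨Nat.count p j, hj⟩ : Fin k) ≠ ⟨Nat.count p i, hi'⟩ := by
            simpa using hi.symm
          simp [Pi.single_eq_of_ne this]
        · rw [hg' hi']
          simp
    -- Here `j` lies in the endless block, and the integer coordinate is reduced modulo `2 ^ (offset
    -- p j + 1)`.
    · refine ⟨(Int.castAddHom _).comp (AddMonoidHom.snd _ _), ?_, fun i hi => ?_⟩
      · rw [hg' hj]
        simp
      · rw [hg (by have := hcount i; have := hcount j; omega)]
        simp

end Blocks

end BlockSum

/-! ### `Π⁰₂` sets, halting problems and infinite c.e. sets. -/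

/-- The `s-m-n` theorem for the enumeration `phi`. -/
theorem exists_computable_phi_eq {g : ℕ → ℕ →. ℕ} (hg : Partrec₂ g) :
    ∃ f : ℕ → ℕ, Computable f ∧ ∀ e n, phi (f e) n = g e n := by
  obtain ⟨c, hc⟩ := Nat.Partrec.Code.exists_code.1 (Partrec₂.unpaired'.2 hg)
  refine ⟨fun e => Encodable.encode (c.curry e), ?_, fun e n => ?_⟩
  · exact (Primrec.encode.comp
      (Nat.Partrec.Code.primrec₂_curry.comp (Primrec.const c) Primrec.id)).to_comp
  · rw [phi, Denumerable.ofNat_encode, Nat.Partrec.Code.eval_curry, hc]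
    simp [Nat.unpaired]

theorem partrec₂_phi : Partrec₂ phi :=
  Nat.Partrec.Code.eval_part.comp ((Computable.ofNat _).comp Computable.fst) Computable.snd

/-- Halting means halting with some amount of fuel, and halting with given fuel is decidable. -/
theorem setOf_forall_dom_mem_PiZeroTwo {g : ℕ → ℕ →. ℕ} (hg : Partrec₂ g) :
    {e | ∀ x, (g e x).Dom} ∈ PiZeroTwo := by
  obtain ⟨c, hc⟩ := Nat.Partrec.Code.exists_code.1 (Partrec₂.unpaired'.2 hg)
  refine ⟨fun q => (c.evaln q.2.2 (Nat.pair q.1 q.2.1)).isSome = true, ⟨inferInstance, ?_⟩, ?_⟩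
  · simp only [Bool.decide_eq_true]
    refine (Primrec.option_isSome.comp (Nat.Partrec.Code.primrec_evaln.comp
      (((Primrec.snd.comp Primrec.snd).pair (Primrec.const c)).pair ?_))).to_comp
    exact Primrec₂.natPair.comp Primrec.fst (Primrec.fst.comp Primrec.snd)
  · intro e
    refine forall_congr' fun x => ?_
    have : g e x = c.eval (Nat.pair e x) := by rw [hc]; simp [Nat.unpaired]
    rw [this, Part.dom_iff_mem]
    simp only [Nat.Partrec.Code.evaln_complete, Option.isSome_iff_exists, Option.mem_def]
    exact exists_comm

/-- Let `x` enter once witnesses `y` have been found for all `x' < x`. The resulting c.e. set is an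
initial segment of `ℕ`, so it is infinite iff every `x` has a witness. -/
theorem exists_computable_ceSet_infinite_iff {S : Set ℕ} (hS : S ∈ PiZeroTwo) :
    ∃ f : ℕ → ℕ, Computable f ∧ ∀ e, (ceSet (f e)).Infinite ↔ e ∈ S := by
  obtain ⟨R, ⟨hdec, hR⟩, hSR⟩ := hS
  let search (e x : ℕ) : Part ℕ := Nat.rfind fun y => Part.some (decide (R (e, x, y)))
  let g (e x : ℕ) : Part ℕ := x.rec (Part.some 0) fun x' prev => prev.bind fun _ => search e x'
  have hsearch : Partrec₂ search := by
    refine Partrec.rfind (p := fun (q : ℕ × ℕ) y => Part.some (decide (R (q.1, q.2, y)))) ?_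
    exact Computable.partrec (hR.comp ((Computable.fst.comp Computable.fst).pair
      ((Computable.snd.comp Computable.fst).pair Computable.snd)))
  have hg : Partrec₂ g := by
    refine Partrec.nat_rec (f := fun q : ℕ × ℕ => q.2) (g := fun _ => Part.some 0)
      (h := fun q r => search q.1 r.1) Computable.snd (Computable.const 0).partrec ?_
    exact hsearch.comp (Computable.fst.comp Computable.fst) (Computable.fst.comp Computable.snd)
  have hsd : ∀ e x, (search e x).Dom ↔ ∃ y, R (e, x, y) := by
    intro e x
    refine Nat.rfind_dom'.trans ?_
    refine ⟨fun ⟨y, hy, _⟩ => ⟨y, by simpa using hy⟩, fun ⟨y, hy⟩ => ⟨y, by simpa using hy, ?_⟩⟩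
    intro m _
    trivial
  have hgd : ∀ e x, (g e x).Dom ↔ ∀ x' < x, ∃ y, R (e, x', y) := by
    intro e x
    induction x with
    | zero => exact ⟨fun _ x' h => absurd h (Nat.not_lt_zero _), fun _ => trivial⟩
    | succ x ih =>
      have : g e (x + 1) = (g e x).bind fun _ => search e x := rfl
      rw [this, Part.bind_dom, Nat.forall_lt_succ_right, ← ih, ← hsd]
      simp
  obtain ⟨f, hf, hfg⟩ := exists_computable_phi_eq hg
  refine ⟨f, hf, fun e => ?_⟩
  have hce : ceSet (f e) = {x | ∀ x' < x, ∃ y, R (e, x', y)} := by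
    ext x
    change (phi (f e) x).Dom ↔ _
    rw [hfg, hgd]
    rfl
  rw [hce, hSR]
  refine ⟨fun h x => ?_, fun h => ?_⟩
  · obtain ⟨z, hz, hxz⟩ := h.exists_gt x
    exact hz x hxz
  · convert Set.infinite_univ (α := ℕ)
    exact Set.eq_univ_of_forall fun z x' _ => h x'

/-! ### Stagewise enumeration of `W_e`. -/

/-- At stage `s = ⟨n, k⟩` the number `n` enters `ceSet e`: the computation of `phi e n` halts with
fuel `k + 1` but not with fuel `k`. -/
def EntersAt (e s : ℕ) : Prop :=
  Nat.Partrec.Code.evaln s.unpair.2 (Denumerable.ofNat _ e) s.unpair.1 = none ∧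
    Nat.Partrec.Code.evaln (s.unpair.2 + 1) (Denumerable.ofNat _ e) s.unpair.1 ≠ none

instance (e : ℕ) : DecidablePred (EntersAt e) := fun _ => inferInstanceAs (Decidable (_ ∧ _))

theorem primrecRel_entersAt : PrimrecRel EntersAt := by
  have hev : Primrec fun q : (ℕ × ℕ) × ℕ => Nat.Partrec.Code.evaln q.2
      (Denumerable.ofNat Nat.Partrec.Code q.1.1) q.1.2.unpair.1 :=
    Nat.Partrec.Code.primrec_evaln.comp
      ((Primrec.snd.pair ((Primrec.ofNat _).comp (Primrec.fst.comp Primrec.fst))).pair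
        (Primrec.fst.comp (Primrec.unpair.comp (Primrec.snd.comp Primrec.fst))))
  have hk : Primrec fun q : ℕ × ℕ => q.2.unpair.2 :=
    Primrec.snd.comp (Primrec.unpair.comp Primrec.snd)
  exact (Primrec.eq.comp (hev.comp (Primrec.id.pair hk)) (Primrec.const none)).and
    (Primrec.eq.comp (hev.comp (Primrec.id.pair (Primrec.succ.comp hk))) (Primrec.const none)).not

theorem evaln_eq_none_of_le {c : Nat.Partrec.Code} {k l n : ℕ} (h : k ≤ l)
    (hl : c.evaln l n = none) : c.evaln k n = none := by
  rw [Option.eq_none_iff_forall_not_mem] at hl ⊢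
  exact fun x hx => hl x (Nat.Partrec.Code.evaln_mono h hx)

/-- Halting is monotone in the fuel, so each element has exactly one threshold and enters at exactly
one stage. Hence the number of closed blocks is the size of `W_e`. -/
theorem bijOn_entersAt (e : ℕ) : Set.BijOn (fun s => s.unpair.1) {s | EntersAt e s} (ceSet e) := by
  refine ⟨fun s hs => ?_, fun s hs t ht hst => ?_, fun n hn => ?_⟩
  · obtain ⟨x, hx⟩ := Option.ne_none_iff_exists'.1 hs.2
    exact Part.dom_iff_mem.2 ⟨x, Nat.Partrec.Code.evaln_sound hx⟩
  · obtain ⟨hs1, hs2⟩ := hs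
    obtain ⟨ht1, ht2⟩ := ht
    simp only at hst
    rw [hst] at hs1 hs2
    have h1 : s.unpair.2 ≤ t.unpair.2 := by
      by_contra! h
      exact ht2 (evaln_eq_none_of_le h hs1)
    have h2 : t.unpair.2 ≤ s.unpair.2 := by
      by_contra! h
      exact hs2 (evaln_eq_none_of_le h ht1)
    rw [← Nat.pair_unpair s, ← Nat.pair_unpair t, hst, le_antisymm h1 h2]
  · classical
    obtain ⟨x, hx⟩ := Part.dom_iff_mem.1 hn
    have hex : ∃ k, (Denumerable.ofNat Nat.Partrec.Code e).evaln k n ≠ none := by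
      obtain ⟨k, hk⟩ := Nat.Partrec.Code.evaln_complete.1 hx
      exact ⟨k, Option.ne_none_iff_exists'.2 ⟨x, hk⟩⟩
    -- No computation halts with fuel 0, so the least sufficient fuel has a predecessor, which is
    -- the second component of the stage.
    have hpos : Nat.find hex ≠ 0 := fun h0 => by
      have := Nat.find_spec hex
      rw [h0] at this
      exact this (by simp [Nat.Partrec.Code.evaln])
    refine ⟨Nat.pair n (Nat.find hex - 1), ⟨?_, ?_⟩, by simp⟩
    · simpa using Nat.find_min hex (m := Nat.find hex - 1) (by omega)
    · simpa [Nat.sub_add_cancel (Nat.one_le_iff_ne_zero.2 hpos)] using Nat.find_spec hex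

/-! ### Uniform computability of the block addition. -/

namespace BlockSum

theorem primrec_two_pow : Primrec fun n : ℕ => 2 ^ n :=
  (Primrec.nat_rec₁ (f := fun _ m => 2 * m) 1
    (Primrec.nat_double.comp Primrec.snd)).of_eq fun n => by
      induction n with
      | zero => rfl
      | succ n ih => rw [pow_succ, ← ih, mul_comm]

theorem primrec_digitSum {α : Type*} [Primcodable α] {f g h k : α → ℕ} (hf : Primrec f)
    (hg : Primrec g) (hh : Primrec h) (hk : Primrec k) :
    Primrec fun x => f x / 2 ^ h x % 2 + g x / 2 ^ h x % 2 + k x + 1 := by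
  have hd : ∀ {f : α → ℕ}, Primrec f → Primrec fun x => f x / 2 ^ h x % 2 := fun hf =>
    Primrec.nat_mod.comp (Primrec.nat_div.comp hf (primrec_two_pow.comp hh)) (Primrec.const 2)
  exact Primrec.succ.comp (Primrec.nat_add.comp (Primrec.nat_add.comp (hd hf) (hd hg)) hk)

variable {p : ℕ → ℕ → Prop} [∀ e, DecidablePred (p e)]

theorem primrec_carry (hp : PrimrecRel p) :
    Primrec₂ fun (q : ℕ × ℕ × ℕ) n => carry (p q.1) q.2.1 q.2.2 n := by
  have hq : Primrec fun r : (((ℕ × ℕ × ℕ) × ℕ) × ℕ × ℕ) => r.1.1 := Primrec.fst.comp Primrec.fst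
  have hn : Primrec fun r : (((ℕ × ℕ × ℕ) × ℕ) × ℕ × ℕ) => r.2.1 := Primrec.fst.comp Primrec.snd
  refine (Primrec.nat_rec' (f := fun r : (ℕ × ℕ × ℕ) × ℕ => r.2) (g := fun _ => 1)
    (h := fun r s => if p r.1.1 s.1 then 1 else
      2 - (r.1.2.1 / 2 ^ s.1 % 2 + r.1.2.2 / 2 ^ s.1 % 2 + s.2 + 1) / 2)
    Primrec.snd (Primrec.const 1) (Primrec.ite (hp.comp (Primrec.fst.comp hq) hn)
      (Primrec.const 1) (Primrec.nat_sub.comp (Primrec.const 2)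
        (Primrec.nat_div.comp (primrec_digitSum (Primrec.fst.comp (Primrec.snd.comp hq))
          (Primrec.snd.comp (Primrec.snd.comp hq)) hn (Primrec.snd.comp Primrec.snd))
            (Primrec.const 2))))).of_eq ?_
  rintro ⟨⟨e, a, b⟩, n⟩
  induction n with
  | zero => rfl
  | succ n ih =>
    simp only [carry] at ih ⊢
    rw [ih]

theorem primrec_blockAdd (hp : PrimrecRel p) :
    Primrec fun q : ℕ × ℕ × ℕ => blockAdd (p q.1) q.2.1 q.2.2 := by
  have ha : Primrec fun q : ℕ × ℕ × ℕ => q.2.1 := Primrec.fst.comp Primrec.snd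
  have hb : Primrec fun q : ℕ × ℕ × ℕ => q.2.2 := Primrec.snd.comp Primrec.snd
  have hn : Primrec fun r : ((ℕ × ℕ × ℕ) × ℕ × ℕ) => r.2.1 := Primrec.fst.comp Primrec.snd
  refine (Primrec.nat_rec' (f := fun q : ℕ × ℕ × ℕ => q.2.1 + q.2.2 + 2) (g := fun _ => 0)
    (h := fun q s => s.2 + (q.2.1 / 2 ^ s.1 % 2 + q.2.2 / 2 ^ s.1 % 2 +
      carry (p q.1) q.2.1 q.2.2 s.1 + 1) % 2 * 2 ^ s.1)
    (Primrec.nat_add.comp (Primrec.nat_add.comp ha hb) (Primrec.const 2)) (Primrec.const 0)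
    (Primrec.nat_add.comp (Primrec.snd.comp Primrec.snd) (Primrec.nat_mul.comp
      (Primrec.nat_mod.comp (primrec_digitSum (ha.comp Primrec.fst) (hb.comp Primrec.fst) hn
        ((primrec_carry hp).comp Primrec.fst hn)) (Primrec.const 2))
          (primrec_two_pow.comp hn)))).of_eq ?_
  rintro ⟨e, a, b⟩
  have h : ∀ N, N.rec (motive := fun _ => ℕ) 0 (fun n s => s + (a / 2 ^ n % 2 + b / 2 ^ n % 2 +
      carry (p e) a b n + 1) % 2 * 2 ^ n) = ∑ n ∈ Finset.range N,
        (a / 2 ^ n % 2 + b / 2 ^ n % 2 + carry (p e) a b n + 1) % 2 * 2 ^ n := by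
    intro N
    induction N with
    | zero => rfl
    | succ N ih => rw [Finset.sum_range_succ, ← ih]
  exact h (a + b + 2)

end BlockSum

/-! ### Torsion is `Π⁰₂`: searching for the order of an element. -/

/-- The product of `a` and `b` in the group with index `e`. -/
def searchMul (e a b : ℕ) : Part ℕ :=
  Nat.rfind fun c => (phi e (Nat.pair 1 (Nat.pair a (Nat.pair b c)))).map fun v => decide (v = 1)

/-- The power `a ^ (n + 1)` in the group with index `e`. -/
def searchPow (e a n : ℕ) : Part ℕ :=
  n.rec (Part.some a) fun _ prev => prev.bind fun c => searchMul e c a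

/-- Searches for an exponent `n` with `a ^ (n + 2) = a` in the group with index `e`, if `a` belongs
to that group. -/
def searchOrder (e a : ℕ) : Part ℕ :=
  (phi e (Nat.pair 0 (Nat.pair a a))).bind fun v =>
    cond (decide (v = 0)) (Part.some 0)
      (Nat.rfind fun n => (searchPow e a (n + 1)).map fun c => decide (c = a))

theorem partrec_searchMul : Partrec fun q : ℕ × ℕ × ℕ => searchMul q.1 q.2.1 q.2.2 := by
  have hcode : Primrec fun r : (ℕ × ℕ × ℕ) × ℕ =>
      Nat.pair 1 (Nat.pair r.1.2.1 (Nat.pair r.1.2.2 r.2)) :=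
    Primrec₂.natPair.comp (Primrec.const 1) (Primrec₂.natPair.comp
      (Primrec.fst.comp (Primrec.snd.comp Primrec.fst)) (Primrec₂.natPair.comp
        (Primrec.snd.comp (Primrec.snd.comp Primrec.fst)) Primrec.snd))
  refine Partrec.rfind (p := fun (q : ℕ × ℕ × ℕ) c =>
    (phi q.1 (Nat.pair 1 (Nat.pair q.2.1 (Nat.pair q.2.2 c)))).map fun v => decide (v = 1)) ?_
  exact (partrec₂_phi.comp (Computable.fst.comp Computable.fst) hcode.to_comp).map
    (Primrec.eq.comp Primrec.snd (Primrec.const 1)).decide.to_comp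

theorem partrec_searchPow : Partrec fun q : (ℕ × ℕ) × ℕ => searchPow q.1.1 q.1.2 q.2 := by
  refine Partrec.nat_rec (f := fun q : (ℕ × ℕ) × ℕ => q.2) (g := fun q => Part.some q.1.2)
    (h := fun q r => searchMul q.1.1 r.2 q.1.2) Computable.snd
    (Computable.snd.comp Computable.fst).partrec ?_
  exact partrec_searchMul.comp (g := fun s : ((ℕ × ℕ) × ℕ) × ℕ × ℕ => (s.1.1.1, s.2.2, s.1.1.2))
    ((Computable.fst.comp (Computable.fst.comp Computable.fst)).pair
    ((Computable.snd.comp Computable.snd).pair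
      (Computable.snd.comp (Computable.fst.comp Computable.fst))))

theorem partrec₂_searchOrder : Partrec₂ searchOrder := by
  have hcode : Primrec fun q : ℕ × ℕ => Nat.pair 0 (Nat.pair q.2 q.2) :=
    Primrec₂.natPair.comp (Primrec.const 0) (Primrec₂.natPair.comp Primrec.snd Primrec.snd)
  have hfind : Partrec fun q : ℕ × ℕ =>
      Nat.rfind fun n => (searchPow q.1 q.2 (n + 1)).map fun c => decide (c = q.2) := by
    refine Partrec.rfind (p := fun (q : ℕ × ℕ) n =>
      (searchPow q.1 q.2 (n + 1)).map fun c => decide (c = q.2)) ?_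
    exact (partrec_searchPow.comp
      (Computable.fst.pair (Computable.succ.comp Computable.snd))).map
      (Primrec.eq.comp Primrec.snd (Primrec.snd.comp (Primrec.fst.comp Primrec.fst))).decide.to_comp
  refine (partrec₂_phi.comp Computable.fst hcode.to_comp).bind
    (g := fun q v => cond (decide (v = 0)) (Part.some 0)
      (Nat.rfind fun n => (searchPow q.1 q.2 (n + 1)).map fun c => decide (c = q.2))) ?_
  exact Partrec.cond (Primrec.eq.comp Primrec.snd (Primrec.const 0)).decide.to_comp
    (Computable.const 0).partrec (hfind.comp Computable.fst)

namespace IsIndexOf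

variable {e : ℕ} {U : Set ℕ} {G : Group U}

theorem phi_eq_one (h : IsIndexOf e U G) {n : ℕ} (hn : n ∈ atomicDiagram U G) :
    phi e n = Part.some 1 :=
  Part.eq_some_iff.2 ((h n).1 hn)

theorem phi_eq_zero (h : IsIndexOf e U G) {n : ℕ} (hn : n ∉ atomicDiagram U G) :
    phi e n = Part.some 0 :=
  Part.eq_some_iff.2 ((h n).2 hn)

theorem searchMul_eq (h : IsIndexOf e U G) (a b : U) :
    searchMul e a b = Part.some ((a * b : U) : ℕ) := by
  refine Part.eq_some_iff.2 (Nat.mem_rfind.2 ⟨?_, fun {c} hc => ?_⟩)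
  · rw [h.phi_eq_one (mem_atomicDiagram_mul.2 rfl)]
    simp
  · have hnot : Nat.pair 1 (Nat.pair (a : ℕ) (Nat.pair b c)) ∉ atomicDiagram U G := by
      rintro (⟨x, y, -, he⟩ | ⟨x, y, z, hxy, he⟩)
      · simp [Nat.pair_eq_pair] at he
      · simp only [Nat.pair_eq_pair, true_and] at he
        obtain ⟨h1, h2, h3⟩ := he
        rw [Subtype.ext h1, Subtype.ext h2, hxy, ← h3] at hc
        exact lt_irrefl _ hc
    rw [h.phi_eq_zero hnot]
    simp

theorem searchPow_eq (h : IsIndexOf e U G) (a : U) (n : ℕ) :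
    searchPow e a n = Part.some ((a ^ (n + 1) : U) : ℕ) := by
  induction n with
  | zero => rw [zero_add, pow_one]; rfl
  | succ n ih =>
    have : searchPow e a (n + 1) = (searchPow e a n).bind fun c => searchMul e c a := rfl
    rw [this, ih, Part.bind_some, h.searchMul_eq, ← pow_succ]

/-- Numbers outside the universe must not spoil the quantifier over all `a`; the code of `a = a`
detects them. -/
theorem searchOrder_dom_of_notMem (h : IsIndexOf e U G) {a : ℕ} (ha : a ∉ U) :
    (searchOrder e a).Dom := by
  rw [searchOrder, h.phi_eq_zero fun hm => ha (mem_atomicDiagram_eq.1 hm).1]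
  simp

theorem searchOrder_dom_iff (h : IsIndexOf e U G) (a : U) :
    (searchOrder e a).Dom ↔ IsOfFinOrder a := by
  rw [searchOrder, h.phi_eq_one (mem_atomicDiagram_eq.2 ⟨a.2, rfl⟩), Part.bind_some,
    isOfFinOrder_iff_pow_eq_one]
  simp only [h.searchPow_eq, Part.map_some, one_ne_zero, decide_false, cond_false]
  refine Nat.rfind_dom'.trans ⟨?_, ?_⟩
  · rintro ⟨n, hn, -⟩
    refine ⟨n + 1, n.succ_pos, ?_⟩
    -- Comparing with `a` rather than with the identity spares the search from having to locate the
    -- identity; cancelling `a` gives `a ^ (n + 1) = 1`.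
    have hn' : a ^ (n + 1 + 1) = a := by simpa [Subtype.ext_iff, eq_comm] using hn
    rwa [pow_succ, mul_eq_right] at hn'
  · rintro ⟨n, hpos, hn⟩
    obtain ⟨m, rfl⟩ : ∃ m, n = m + 1 := ⟨n - 1, by omega⟩
    refine ⟨m, ?_, fun _ => trivial⟩
    rw [pow_succ a (m + 1), hn, one_mul]
    simp

theorem forall_searchOrder_dom_iff (h : IsIndexOf e U G) :
    (∀ a, (searchOrder e a).Dom) ↔ IsMulTorsion U := by
  refine ⟨fun H a => (h.searchOrder_dom_iff a).1 (H a), fun H a => ?_⟩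
  by_cases ha : a ∈ U
  · exact (h.searchOrder_dom_iff ⟨a, ha⟩).2 (H ⟨a, ha⟩)
  · exact h.searchOrder_dom_of_notMem ha

end IsIndexOf

theorem detectingIsIn_isMulTorsion :
    DetectingIsIn PiZeroTwo computableGroupIndices (fun G _ => IsMulTorsion G) := by
  refine ⟨_, setOf_forall_dom_mem_PiZeroTwo partrec₂_searchOrder, ?_⟩
  ext e
  refine and_congr_right fun ⟨U, G, hG⟩ => ?_
  rw [hG.mem_indicesWithProperty_iff]
  exact hG.forall_searchOrder_dom_iff

/-! ### Indices for the block groups. -/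

namespace BlockSum

/-- The characteristic function of the atomic diagram of the structure on `ℕ` with the
multiplication `blockAdd p`. -/
def diagram (p : ℕ → Prop) [DecidablePred p] (n : ℕ) : ℕ :=
  if n.unpair.1 = 0 then if n.unpair.2.unpair.1 = n.unpair.2.unpair.2 then 1 else 0
  else if n.unpair.1 = 1 ∧ blockAdd p n.unpair.2.unpair.1 n.unpair.2.unpair.2.unpair.1 =
    n.unpair.2.unpair.2.unpair.2 then 1 else 0

theorem primrec_diagram {p : ℕ → ℕ → Prop} [∀ e, DecidablePred (p e)] (hp : PrimrecRel p) :
    Primrec₂ fun e n => diagram (p e) n := by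
  have h1 : Primrec fun n : ℕ => n.unpair.1 := Primrec.fst.comp Primrec.unpair
  have h2 : Primrec fun n : ℕ => n.unpair.2 := Primrec.snd.comp Primrec.unpair
  have ht : Primrec fun q : ℕ × ℕ => q.2.unpair.1 := h1.comp Primrec.snd
  have ha : Primrec fun q : ℕ × ℕ => q.2.unpair.2.unpair.1 := h1.comp (h2.comp Primrec.snd)
  have hr : Primrec fun q : ℕ × ℕ => q.2.unpair.2.unpair.2 := h2.comp (h2.comp Primrec.snd)
  have hmul : Primrec fun q : ℕ × ℕ =>
      blockAdd (p q.1) q.2.unpair.2.unpair.1 q.2.unpair.2.unpair.2.unpair.1 :=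
    (primrec_blockAdd hp).comp (g := fun q : ℕ × ℕ =>
      (q.1, q.2.unpair.2.unpair.1, q.2.unpair.2.unpair.2.unpair.1))
      (Primrec.fst.pair (ha.pair (h1.comp hr)))
  simp only [diagram]
  exact Primrec.ite (Primrec.eq.comp ht (Primrec.const 0))
    (Primrec.ite (Primrec.eq.comp ha hr) (Primrec.const 1) (Primrec.const 0))
    (Primrec.ite ((Primrec.eq.comp ht (Primrec.const 1)).and (Primrec.eq.comp hmul (h2.comp hr)))
      (Primrec.const 1) (Primrec.const 0))

theorem isIndexOf_of_phi_eq_diagram {p : ℕ → Prop} [DecidablePred p] {e : ℕ}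
    {G : Group (Set.univ : Set ℕ)} (he : ∀ n, phi e n = Part.some (diagram p n))
    (hG : ∀ a b : (Set.univ : Set ℕ), ((a * b : (Set.univ : Set ℕ)) : ℕ) = blockAdd p a b) :
    IsIndexOf e Set.univ G := by
  intro n
  have h01 : diagram p n = 1 ∨ diagram p n = 0 := by
    unfold diagram
    split_ifs <;> simp
  have h1 : diagram p n = 1 ↔ n ∈ atomicDiagram Set.univ G := by
    constructor
    · intro h
      rw [diagram] at h
      split_ifs at h with hn hab hn
      · refine Or.inl ⟨⟨_, trivial⟩, ⟨_, trivial⟩, Subtype.ext hab, ?_⟩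
        simp only
        rw [Nat.pair_unpair, ← hn, Nat.pair_unpair]
      · refine Or.inr ⟨⟨n.unpair.2.unpair.1, trivial⟩, ⟨n.unpair.2.unpair.2.unpair.1, trivial⟩,
          ⟨n.unpair.2.unpair.2.unpair.2, trivial⟩, Subtype.ext ((hG _ _).trans hn.2), ?_⟩
        simp only
        rw [Nat.pair_unpair, Nat.pair_unpair, ← hn.1, Nat.pair_unpair]
    · rintro (⟨a, b, rfl, rfl⟩ | ⟨a, b, c, rfl, rfl⟩)
      · simp [diagram]
      · simp [diagram, hG]
  rw [he]
  refine ⟨fun h => ?_, fun h => ?_⟩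
  · rw [h1.2 h]; exact Part.mem_some 1
  · rw [h01.resolve_left fun h' => h (h1.1 h')]; exact Part.mem_some 0

/-- Transport of an additive group structure to `ℕ`. -/
theorem exists_commGroup {p : ℕ → Prop} [DecidablePred p] {e : ℕ}
    (he : ∀ n, phi e n = Part.some (diagram p n)) {H : Type} [AddCommGroup H] (E : ℕ ≃ H)
    (hE : ∀ a b, E (blockAdd p a b) = E a + E b) :
    ∃ G : CommGroup (Set.univ : Set ℕ), IsIndexOf e Set.univ G.toGroup ∧
      Nonempty ((Set.univ : Set ℕ) ≃* Multiplicative H) := by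
  let F : (Set.univ : Set ℕ) ≃ Multiplicative H :=
    (Equiv.Set.univ ℕ).trans (E.trans Multiplicative.ofAdd)
  refine ⟨F.commGroup, isIndexOf_of_phi_eq_diagram (p := p) he fun a b => ?_, ⟨?_⟩⟩
  · have : (⟨blockAdd p a b, trivial⟩ : (Set.univ : Set ℕ)) = F.symm (F a * F b) := by
      rw [Equiv.eq_symm_apply]
      exact congrArg Multiplicative.ofAdd (hE a b)
    exact (congrArg Subtype.val this).symm
  · letI := F.commGroup
    exact { F with map_mul' := fun a b => F.apply_symm_apply _ }

end BlockSum

/-! ### Torsion of the block groups and `Π⁰₂`-hardness. -/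

theorem isMulTorsion_directSum_zmod (a : ℕ → ℕ) :
    IsMulTorsion (Multiplicative (DirectSum ℕ fun i => ZMod (2 ^ a i))) := by
  intro x
  rw [← ofAdd_toAdd x, isOfFinOrder_ofAdd_iff]
  induction x.toAdd using DirectSum.induction_on with
  | zero => exact IsOfFinAddOrder.zero
  | of i z => exact (DirectSum.of (fun i => ZMod (2 ^ a i)) i).isOfFinAddOrder (isOfFinAddOrder_of_finite z)
  | add x y hx hy => exact hx.add hy

theorem not_isMulTorsion_prod_int {k : ℕ} (a : Fin k → ℕ) :
    ¬ IsMulTorsion (Multiplicative ((∀ i, ZMod (2 ^ a i)) × ℤ)) := by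
  intro h
  have h1 := isOfFinOrder_ofAdd_iff.1 (h (Multiplicative.ofAdd (0, 1)))
  simp [isOfFinAddOrder_iff_nsmul_eq_zero] at h1

theorem exists_computable_index_blockSum :
    ∃ f : ℕ → ℕ, Computable f ∧ ∀ e : ℕ,
      ∃ G : CommGroup (Set.univ : Set ℕ), IsIndexOf (f e) Set.univ G.toGroup ∧
        ((ceSet e).Infinite →
          IsMulTorsion (Set.univ : Set ℕ) ∧
          ∃ a : ℕ → ℕ, (∀ i, 1 ≤ a i) ∧
            Nonempty ((Set.univ : Set ℕ) ≃*
              Multiplicative (DirectSum ℕ fun i => ZMod (2 ^ a i)))) ∧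
        ((ceSet e).Finite →
          ¬ IsMulTorsion (Set.univ : Set ℕ) ∧
          ∃ a : Fin (ceSet e).ncard → ℕ, (∀ i, 1 ≤ a i) ∧
            Nonempty ((Set.univ : Set ℕ) ≃*
              Multiplicative ((∀ i, ZMod (2 ^ a i)) × ℤ))) := by
  obtain ⟨f, hf, hphi⟩ := exists_computable_phi_eq
    (BlockSum.primrec_diagram primrecRel_entersAt).to_comp.partrec₂
  refine ⟨f, hf, fun e => ?_⟩
  have hbij := bijOn_entersAt e
  rcases (ceSet e).finite_or_infinite with hfin | hinf
  · have hfin' : {s | EntersAt e s}.Finite := hbij.finite_iff_finite.2 hfin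
    have hcard : hfin'.toFinset.card = (ceSet e).ncard := by
      rw [← Set.ncard_eq_toFinset_card _ hfin', ← hbij.image_eq, hbij.injOn.ncard_image]
    obtain ⟨E, hE⟩ := BlockSum.exists_equiv_of_finite hfin' hcard
    obtain ⟨G, hG, ⟨φ⟩⟩ := BlockSum.exists_commGroup (hphi e) E hE
    exact ⟨G, hG, fun hinf => absurd hfin hinf, fun _ =>
      -- Torsion passes to homomorphic images, hence across the isomorphism `φ`.
      ⟨fun h => not_isMulTorsion_prod_int _ (h.of_surjective (f := φ.toMonoidHom) φ.surjective),
        _, fun i => Nat.succ_pos _, ⟨φ⟩⟩⟩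
  · have hinf' : {s | EntersAt e s}.Infinite := fun h => hinf (hbij.finite_iff_finite.1 h)
    obtain ⟨E, hE⟩ := BlockSum.exists_equiv_of_infinite hinf'
    obtain ⟨G, hG, ⟨φ⟩⟩ := BlockSum.exists_commGroup (hphi e) E hE
    exact ⟨G, hG, fun _ => ⟨(isMulTorsion_directSum_zmod _).of_surjective
      (f := φ.symm.toMonoidHom) φ.symm.surjective, _, fun i => Nat.succ_pos _, ⟨φ⟩⟩,
        fun hfin => absurd hfin hinf⟩

theorem detectingIsHard_isMulTorsion :
    DetectingIsHard PiZeroTwo computableGroupIndices (fun G _ => IsMulTorsion G) := by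
  intro S hS
  obtain ⟨g, hg, hgS⟩ := exists_computable_ceSet_infinite_iff hS
  obtain ⟨f, hf, hfG⟩ := exists_computable_index_blockSum
  have hmem : ∀ e, f (g e) ∈ computableGroupIndices := fun e => by
    obtain ⟨G, hG, -⟩ := hfG (g e)
    exact ⟨_, _, hG⟩
  refine ⟨fun e => f (g e), hf.comp hg, hmem, fun e => ?_⟩
  obtain ⟨G, hG, hinf, hfin⟩ := hfG (g e)
  rw [← hgS, Set.mem_inter_iff, and_iff_right (hmem e), hG.mem_indicesWithProperty_iff]
  refine ⟨fun h => (hinf h).1, fun h => ?_⟩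
  by_contra hnot
  exact (hfin (Set.not_infinite.1 hnot)).1 h

theorem mainTheorem8 :
    DetectingIsComplete PiZeroTwo computableGroupIndices (fun G _ => IsMulTorsion G) ∧
    ∃ f : ℕ → ℕ, Computable f ∧ ∀ e : ℕ,
      ∃ G : CommGroup (Set.univ : Set ℕ), IsIndexOf (f e) Set.univ G.toGroup ∧
        ((ceSet e).Infinite →
          IsMulTorsion (Set.univ : Set ℕ) ∧
          ∃ a : ℕ → ℕ, (∀ i, 1 ≤ a i) ∧
            Nonempty ((Set.univ : Set ℕ) ≃*
              Multiplicative (DirectSum ℕ fun i => ZMod (2 ^ a i)))) ∧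
        ((ceSet e).Finite →
          ¬ IsMulTorsion (Set.univ : Set ℕ) ∧
          ∃ a : Fin (ceSet e).ncard → ℕ, (∀ i, 1 ≤ a i) ∧
            Nonempty ((Set.univ : Set ℕ) ≃*
              Multiplicative ((∀ i, ZMod (2 ^ a i)) × ℤ))) :=
  ⟨⟨detectingIsIn_isMulTorsion, detectingIsHard_isMulTorsion⟩, exists_computable_index_blockSum⟩
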